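/- Let $m,q\ge 0$, $X=\{x_0,\dots,x_m\}$, $X'=\{x'_0,\dots,x'_q\}$. Let $\mathbb R^{\ell}\langle\langle X\rangle\rangle$ be the set of $\ell$-tuples of real formal power series in the non-commuting letters of $X$; write $c(\eta)\in\mathbb R^\ell$ for the coefficient of $c$ at the word $\eta$, $\emptyset$ for the series $1$, and $\mathbb 1=(\emptyset,\dots,\emptyset)$. Products and inverses for the shuffle product ш are taken componentwise. A tuple $d$ is purely improper if every component has a nonzero constant term. Put $d_0:=\emptyset$ and define, by linear and locally finite extension from words: * for $c\in\mathbb R^k\langle\langle X'\rangle\rangle$, $d\in\mathbb R^q\langle\langle X\rangle\rangle$: $c\circ d=\sum_{\eta} c(\eta)\,\psi_d(\eta)(\emptyset)$, where $\psi_d(x'_{i_1}\cdots x'_{i_r})=\psi_d(x'_{i_1})\circ\cdots\circ\psi_d(x'_{i_r})$ and $\psi_d(x'_i)(e)=x_0(d_i\,ш\,e)$; * for $c\in\mathbb R^p\langle\langle X\rangle\rangle$, $d\in\mathbb R^m\langle\langle X\rangle\rangle$: $c\curvearrowleft d=\sum_\eta c(\eta)\,(\eta\curvearrowleft d)$, where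 $\emptyset\curvearrowleft d=\emptyset$ and $x_i\eta\curvearrowleft d=x_i\big(d_i\,ш\,(\eta\curvearrowleft d)\big)$ for $0\le i\le m$; * for $c,d\in\mathbb R^m\langle\langle X\rangle\rangle$: $c\star d=d\,ш\,(c\curvearrowleft d)$. Let $\kappa(c,d)=\sigma^{\mathrm{val}(c-d)}$ (and $\kappa(c,c)=0$), $0<\sigma<1$, where $\mathrm{val}$ is the least length of a word occurring in some component. For an input $u\in\mathbb R[[t]]^m$ put $u_0=1$, $F_\emptyset[u]=1$, $F_{x_i\eta}[u](t)=\int_0^t u_i(\tau)F_\eta[u](\tau)\,d\tau$, and $F_c[u]=\sum_\eta c(\eta)F_\eta[u]$ (the formal Chen–Fliess series; the sum is locally finite in $\mathbb R[[t]]$). For $c\in\mathbb R^q\langle\langle X\rangle\rangle$ and $d\in\mathbb R^m\langle\langle X'\rangle\rangle$, the closed loop under multiplicative output feedback with external input $v\in\mathbb R[[t]]^m$ is the system $y=F_c[u]$, $u_i=v_i\,F_{d_i}[y]$ $(1\le i\le m)$. A series $e\in\mathbb R^q\langle\langle X\rangle\rangle$ is a generating series of the closed loop if, for every $v$, this system has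 a solution $(u,y)$, and every solution has $y=F_e[v]$. **Theorem.** Let $c\in\mathbb R^q\langle\langle X\rangle\rangle$ and let $d\in\mathbb R^m\langle\langle X'\rangle\rangle$ be purely improper. Then: 1. $d$ has a unique shuffle inverse $d^{ш-1}$, and $d^{ш-1}\circ c$ has a unique two-sided inverse for $\star$ (with identity $\mathbb 1$); hence the multiplicative dynamic feedback product $$c\,\check{@}\,d:=c\curvearrowleft\big(d^{ш-1}\circ c\big)^{\star-1}\in\mathbb R^q\langle\langle X\rangle\rangle$$ is well defined. 2. $c\,\check{@}\,d$ is a generating series of the closed loop, and it is the only one. 3. The map $e\mapsto c\curvearrowleft(d\circ e)$ on the ultrametric space $(\mathbb R^q\langle\langle X\rangle\rangle,\kappa)$ is a strong contraction, $\kappa\big(c\curvearrowleft(d\circ e),\,c\curvearrowleft(d\circ e')\big)\le\sigma\,\kappa(e,e')$ for all $e,e'$ and all $\sigma\in(0,1)$, and $c\,\check{@}\,d$ is its unique fixed point. -/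

import Mathlib

noncomputable section

namespace ChenFliess

/-- `ℝ⟨⟨X⟩⟩` for the alphabet `X = {x₀, x₁, …, x_m}`: a formal power series is its family of
coefficients, indexed by the words over `X`; the letter `x_i` is `i : Fin (m + 1)`. -/
abbrev Series (m : ℕ) : Type := List (Fin (m + 1)) → ℝ

/-- `ℝ^ℓ⟨⟨X⟩⟩` for `X = {x₀, …, x_m}`. -/
abbrev VSeries (ℓ m : ℕ) : Type := Fin ℓ → Series m

/-- The series `∅`, whose only nonzero coefficient is a `1` at the empty word. -/
def one {m : ℕ} : Series m
  | [] => 1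
  | _ :: _ => 0

/-- The vector `𝟙 = (∅, …, ∅)`. -/
def vone {ℓ m : ℕ} : VSeries ℓ m := fun _ => one

/-- Left catenation by a letter, `c ↦ x_i c`. -/
def prepend {m : ℕ} (i : Fin (m + 1)) (c : Series m) : Series m
  | [] => 0
  | j :: w => if j = i then c w else 0

/-- The terms, listed with multiplicity, of the unshuffle coproduct of a word, that is of the
multiplicative map with `Δ(x) = x ⊗ 1 + 1 ⊗ x` on letters. -/
def unshuffle {α : Type} : List α → List (List α × List α)
  | [] => [([], [])]
  | x :: w =>
      (unshuffle w).map (fun p => (x :: p.1, p.2)) ++ (unshuffle w).map (fun p => (p.1, x :: p.2))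

/-- The shuffle product of two series (the convolution product for the unshuffle coproduct). -/
def shuffle {m : ℕ} (c d : Series m) : Series m :=
  fun η => ((unshuffle η).map (fun p => c p.1 * d p.2)).sum

/-- The componentwise shuffle product of vectors of series. -/
def vshuffle {ℓ m : ℕ} (c d : VSeries ℓ m) : VSeries ℓ m := fun i => shuffle (c i) (d i)

/-- A vector of series is purely improper if every component has a nonzero constant term. -/
def PurelyImproper {ℓ m : ℕ} (c : VSeries ℓ m) : Prop := ∀ i, c i [] ≠ 0

/-- `(d₀, d₁, …, d_ℓ)` with the convention `d₀ = ∅`. -/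
def extend {ℓ m : ℕ} (d : VSeries ℓ m) : Fin (ℓ + 1) → Series m := Fin.cons one d

/-- `ψ_d(η)(∅)`, where `ψ_d` sends catenation to composition of maps and
`ψ_d(x'_i)(e) = x₀ (d_i ш e)`. -/
def compWord {ℓ m : ℕ} (d : VSeries ℓ m) : List (Fin (ℓ + 1)) → Series m
  | [] => one
  | i :: η => prepend 0 (shuffle (extend d i) (compWord d η))

/-- The composition product `c ∘ d = ∑_η c(η) ψ_d(η)(∅)`. Each coefficient is a finite sum, see
`finite_support_comp`. -/
def comp {k ℓ m : ℕ} (c : VSeries k ℓ) (d : VSeries ℓ m) : VSeries k m :=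
  fun j ξ => ∑ᶠ η : List (Fin (ℓ + 1)), c j η * compWord d η ξ

/-- `η ↶ d`, where `x_i η ↶ d = x_i (d_i ш (η ↶ d))`, and `d₀ = ∅` so that
`x₀ η ↶ d = x₀ (η ↶ d)`. -/
def mixWord {m : ℕ} (d : VSeries m m) : List (Fin (m + 1)) → Series m
  | [] => one
  | i :: η => prepend i (shuffle (extend d i) (mixWord d η))

/-- The multiplicative mixed composition product `c ↶ d = ∑_η c(η) (η ↶ d)`. Each coefficient is a
finite sum, see `finite_support_mix`. -/
def mix {p m : ℕ} (c : VSeries p m) (d : VSeries m m) : VSeries p m :=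
  fun j ξ => ∑ᶠ η : List (Fin (m + 1)), c j η * mixWord d η ξ

/-- The multiplicative composition product `c ⋆ d = d ш (c ↶ d)`. -/
def star {m : ℕ} (c d : VSeries m m) : VSeries m m := vshuffle d (mix c d)

/-- `e` is the inverse of `d` for the (commutative) shuffle product. -/
def IsShuffleInverse {ℓ m : ℕ} (d e : VSeries ℓ m) : Prop := vshuffle d e = vone

/-- `e` is the two-sided inverse of `d` for the product `⋆`. -/
def IsStarInverse {m : ℕ} (d e : VSeries m m) : Prop := star d e = vone ∧ star e d = vone

/-- The shuffle inverse `d^{ш -1}` (an arbitrary series if there is none). -/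
def shuffleInv {ℓ m : ℕ} (d : VSeries ℓ m) : VSeries ℓ m :=
  Classical.epsilon (fun e => IsShuffleInverse d e)

/-- The inverse `d^{⋆ -1}` for the product `⋆` (an arbitrary series if there is none). -/
def starInv {m : ℕ} (d : VSeries m m) : VSeries m m :=
  Classical.epsilon (fun e => IsStarInverse d e)

/-- The multiplicative dynamic feedback product `c ↶ (d^{ш -1} ∘ c)^{⋆ -1}`. -/
def feedback {q m : ℕ} (c : VSeries q m) (d : VSeries m q) : VSeries q m :=
  mix c (starInv (comp (shuffleInv d) c))

/-- The ultrametric `κ(c, d) = σ ^ val(c - d)`, where `val` is the least length of a word that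
occurs in some component, and `κ(c, c) = 0`. -/
def kappa {ℓ m : ℕ} (σ : ℝ) (c d : VSeries ℓ m) : ℝ :=
  open Classical in
  if c = d then 0 else σ ^ sInf {n : ℕ | ∃ i η, c i η - d i η ≠ 0 ∧ List.length η = n}

/-- Formal integration `f ↦ ∫₀ᵗ f(τ) dτ` in `ℝ⟦t⟧`. -/
def integral (f : PowerSeries ℝ) : PowerSeries ℝ :=
  PowerSeries.mk fun n =>
    match n with
    | 0 => 0
    | k + 1 => PowerSeries.coeff k f / ((k : ℝ) + 1)

/-- The iterated integral `F_η[u] ∈ ℝ⟦t⟧` of an input `u ∈ ℝ⟦t⟧^m`: `F_∅[u] = 1` and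
`F_{x_i η}[u](t) = ∫₀ᵗ u_i(τ) F_η[u](τ) dτ`, with `u₀ = 1`. -/
def iteratedIntegral {m : ℕ} (u : Fin m → PowerSeries ℝ) : List (Fin (m + 1)) → PowerSeries ℝ
  | [] => 1
  | i :: η =>
      integral ((Fin.cons 1 u : Fin (m + 1) → PowerSeries ℝ) i * iteratedIntegral u η)

/-- The formal Chen--Fliess series `F_c[u] = ∑_η c(η) F_η[u]`, with inputs and outputs in `ℝ⟦t⟧`.
Each coefficient is a finite sum, see `finite_support_chenFliess`. -/
def chenFliess {ℓ m : ℕ} (c : VSeries ℓ m) (u : Fin m → PowerSeries ℝ) : Fin ℓ → PowerSeries ℝ :=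
  fun j => PowerSeries.mk fun n =>
    ∑ᶠ η : List (Fin (m + 1)), c j η * PowerSeries.coeff n (iteratedIntegral u η)

/-- The signals of the multiplicative output feedback loop with external input `v`, plant input
`u` and output `y`: `y = F_c[u]` and `u = v · F_d[y]` (componentwise product). -/
def IsClosedLoop {q m : ℕ} (c : VSeries q m) (d : VSeries m q)
    (v u : Fin m → PowerSeries ℝ) (y : Fin q → PowerSeries ℝ) : Prop :=
  y = chenFliess c u ∧ ∀ i, u i = v i * chenFliess d y i

/-- `e` is a generating series of the closed loop: for every external input `v` the loop has the
output `y = F_e[v]`, and no other. -/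
def IsClosedLoopSeries {q m : ℕ} (c : VSeries q m) (d : VSeries m q) (e : VSeries q m) : Prop :=
  ∀ (v : Fin m → PowerSeries ℝ) (y : Fin q → PowerSeries ℝ),
    (∃ u, IsClosedLoop c d v u y) ↔ y = chenFliess e v

/-! Local finiteness of the infinite sums above. -/

theorem length_of_mem_unshuffle {α : Type} {η : List α} :
    ∀ {p : List α × List α}, p ∈ unshuffle η → p.2.length ≤ η.length := by
  induction η with
  | nil => simp [unshuffle]
  | cons x w ih =>
    intro p hp
    simp only [unshuffle, List.mem_append, List.mem_map] at hp
    rcases hp with ⟨r, hr, rfl⟩ | ⟨r, hr, rfl⟩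
    · have := ih hr
      simp only [List.length_cons]
      omega
    · have := ih hr
      simp only [List.length_cons]
      omega

theorem shuffle_eq_zero {m n : ℕ} (c d : Series m) (hd : ∀ ξ, List.length ξ < n → d ξ = 0)
    (ξ : List (Fin (m + 1))) (hξ : ξ.length < n) : shuffle c d ξ = 0 := by
  unfold shuffle
  apply List.sum_eq_zero
  intro a ha
  obtain ⟨p, hp, rfl⟩ := List.mem_map.1 ha
  rw [hd p.2 (lt_of_le_of_lt (length_of_mem_unshuffle hp) hξ), mul_zero]

theorem prepend_eq_zero {m n : ℕ} (i : Fin (m + 1)) (c : Series m)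
    (hc : ∀ ξ, List.length ξ < n → c ξ = 0)
    (ξ : List (Fin (m + 1))) (hξ : ξ.length < n + 1) : prepend i c ξ = 0 := by
  cases ξ with
  | nil => rfl
  | cons j w =>
    simp only [List.length_cons] at hξ
    simp [prepend, hc w (by omega)]

theorem compWord_eq_zero {ℓ m : ℕ} (d : VSeries ℓ m) (η : List (Fin (ℓ + 1))) :
    ∀ ξ, List.length ξ < η.length → compWord d η ξ = 0 := by
  induction η with
  | nil => simp
  | cons i η ih => exact prepend_eq_zero _ _ (shuffle_eq_zero _ _ ih)

theorem mixWord_eq_zero {m : ℕ} (d : VSeries m m) (η : List (Fin (m + 1))) :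
    ∀ ξ, List.length ξ < η.length → mixWord d η ξ = 0 := by
  induction η with
  | nil => simp
  | cons i η ih => exact prepend_eq_zero _ _ (shuffle_eq_zero _ _ ih)

theorem coeff_iteratedIntegral_eq_zero {m : ℕ} (u : Fin m → PowerSeries ℝ)
    (η : List (Fin (m + 1))) :
    ∀ n, n < η.length → PowerSeries.coeff n (iteratedIntegral u η) = 0 := by
  induction η with
  | nil => simp
  | cons i η ih =>
    intro n hn
    simp only [List.length_cons] at hn
    cases n with
    | zero => simp [iteratedIntegral, integral]
    | succ k =>
      simp only [iteratedIntegral, integral, PowerSeries.coeff_mk]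
      rw [PowerSeries.coeff_mul, Finset.sum_eq_zero, zero_div]
      intro p hp
      have h_sum := Finset.HasAntidiagonal.mem_antidiagonal.1 hp
      rw [ih p.2 (by omega), mul_zero]

theorem finite_of_length_le {k : ℕ} (f : List (Fin k) → ℝ) (N : ℕ)
    (hf : ∀ η, N < List.length η → f η = 0) : f.support.Finite := by
  refine (List.finite_length_le (Fin k) N).subset fun η hη => ?_
  by_contra h
  exact hη (hf η (not_le.1 h))

theorem finite_support_comp {k ℓ m : ℕ} (c : VSeries k ℓ) (d : VSeries ℓ m) (j : Fin k)
    (ξ : List (Fin (m + 1))) : (Function.support fun η => c j η * compWord d η ξ).Finite :=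
  finite_of_length_le _ ξ.length fun η h => by simp [compWord_eq_zero d η ξ h]

theorem finite_support_mix {p m : ℕ} (c : VSeries p m) (d : VSeries m m) (j : Fin p)
    (ξ : List (Fin (m + 1))) : (Function.support fun η => c j η * mixWord d η ξ).Finite :=
  finite_of_length_le _ ξ.length fun η h => by simp [mixWord_eq_zero d η ξ h]

theorem finite_support_chenFliess {ℓ m : ℕ} (c : VSeries ℓ m) (u : Fin m → PowerSeries ℝ)
    (j : Fin ℓ) (n : ℕ) :
    (Function.support fun η =>
      c j η * PowerSeries.coeff n (iteratedIntegral u η)).Finite :=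
  finite_of_length_le _ n fun η h => by simp [coeff_iteratedIntegral_eq_zero u η n h]

end ChenFliess

end

noncomputable section

namespace ChenFliess

open Filter Topology PowerSeries

/-! A series is studied through its operator `F_c` on formal inputs. Shuffle becomes the pointwise
product (`fliess_shuffle`), `∘` becomes cascading (`chenFliess_comp`), and `c ↶ d` becomes `v ↦
F_c[v · F_d[v]]` (`chenFliess_mix`). Since the operator determines the series
(`chenFliess_injective`), identities between series, such as associativity of `⋆`, reduce to short
computations with functions.

Existence comes from completeness: a map that gains one degree of agreement has exactly one fixed
point. Shuffle inverses and right `⋆`-inverses are obtained as such fixed points.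

For `h = (d^{ш -1} ∘ c)^{⋆ -1}`, the equation defining `h` amounts to `h = d ∘ (c ↶ h)`, so `c ↶ h`
is fixed by `e ↦ c ↶ (d ∘ e)`. A fixed point satisfies `F_e[v] = F_c[v · F_d[F_e[v]]]`, which is the
loop equation. Causality makes the loop input unique, and injectivity makes the generating series
unique. -/

/-- The finite set of words of length at most `n`. -/
def wordsLE (α : Type) [Fintype α] [DecidableEq α] : ℕ → Finset (List α)
  | 0 => {[]}
  | n + 1 => insert [] ((Finset.univ ×ˢ wordsLE α n).image fun p => p.1 :: p.2)

theorem mem_wordsLE {α : Type} [Fintype α] [DecidableEq α] {n : ℕ} {η : List α} :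
    η ∈ wordsLE α n ↔ η.length ≤ n := by
  induction n generalizing η with
  | zero => simp [wordsLE]
  | succ n ih => cases η <;> simp [wordsLE, ih]

theorem sum_wordsLE_succ {α M : Type} [Fintype α] [DecidableEq α] [AddCommMonoid M] (n : ℕ)
    (f : List α → M) :
    ∑ η ∈ wordsLE α (n + 1), f η = f [] + ∑ i, ∑ η ∈ wordsLE α n, f (i :: η) := by
  rw [wordsLE, Finset.sum_insert (by simp), Finset.sum_image, Finset.sum_product]
  rintro ⟨a, b⟩ - ⟨a', b'⟩ - h
  simpa using h

/-- A sum over all words whose terms vanish on words longer than `N`. -/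
theorem finsum_eq_sum_wordsLE {α : Type} [Fintype α] [DecidableEq α] (f : List α → ℝ) (N : ℕ)
    (hf : ∀ η, N < η.length → f η = 0) : ∑ᶠ η, f η = ∑ η ∈ wordsLE α N, f η := by
  refine finsum_eq_sum_of_support_subset _ fun η hη => ?_
  by_contra h
  exact hη (hf η (by simpa [mem_wordsLE] using h))

/-! ### Differential calculus of Chen–Fliess series. -/

/-- The formal Chen--Fliess series of a scalar series. -/
def fliess {m : ℕ} (c : Series m) (u : Fin m → PowerSeries ℝ) : PowerSeries ℝ :=
  PowerSeries.mk fun n => ∑ᶠ η, c η * coeff n (iteratedIntegral u η)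

theorem chenFliess_apply {ℓ m : ℕ} (c : VSeries ℓ m) (u : Fin m → PowerSeries ℝ) (j : Fin ℓ) :
    chenFliess c u j = fliess (c j) u := rfl

theorem coeff_fliess {m : ℕ} (c : Series m) (u : Fin m → PowerSeries ℝ) {n N : ℕ} (h : n ≤ N) :
    coeff n (fliess c u) =
      ∑ η ∈ wordsLE (Fin (m + 1)) N, c η * coeff n (iteratedIntegral u η) := by
  rw [fliess, coeff_mk]
  refine finsum_eq_sum_wordsLE _ _ fun η hη => ?_
  rw [coeff_iteratedIntegral_eq_zero u η n (h.trans_lt hη), mul_zero]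

theorem coeff_zero_fliess {m : ℕ} (c : Series m) (u : Fin m → PowerSeries ℝ) :
    coeff 0 (fliess c u) = c [] := by
  simp [coeff_fliess c u le_rfl, wordsLE, iteratedIntegral]

theorem fliess_sub {m : ℕ} (c d : Series m) (u : Fin m → PowerSeries ℝ) :
    fliess (c - d) u = fliess c u - fliess d u := by
  ext n
  simp only [map_sub, coeff_fliess _ u le_rfl, ← Finset.sum_sub_distrib, Pi.sub_apply, sub_mul]

theorem fliess_add {m : ℕ} (c d : Series m) (u : Fin m → PowerSeries ℝ) :
    fliess (c + d) u = fliess c u + fliess d u := by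
  ext n
  simp only [map_add, coeff_fliess _ u le_rfl, ← Finset.sum_add_distrib, Pi.add_apply, add_mul]

/-- The input `(u₀, u₁, …, u_m)` with the convention `u₀ = 1`. -/
def extendInput {m : ℕ} (u : Fin m → PowerSeries ℝ) : Fin (m + 1) → PowerSeries ℝ := Fin.cons 1 u

/-- The left shift `x_i⁻¹ c` of a series by a letter. -/
def leftDeriv {m : ℕ} (i : Fin (m + 1)) (c : Series m) : Series m := fun η => c (i :: η)

theorem coeff_succ_integral (f : PowerSeries ℝ) (n : ℕ) :
    coeff (n + 1) (integral f) = coeff n f / ((n : ℝ) + 1) := by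
  simp [integral]

theorem coeff_zero_integral (f : PowerSeries ℝ) : coeff 0 (integral f) = 0 := by
  simp only [integral, coeff_mk]

theorem derivative_integral (f : PowerSeries ℝ) : derivative ℝ (integral f) = f := by
  ext n
  rw [coeff_derivative, coeff_succ_integral]
  field_simp

theorem eq_of_derivative_eq {f g : PowerSeries ℝ} (h0 : coeff 0 f = coeff 0 g)
    (h : derivative ℝ f = derivative ℝ g) : f = g :=
  derivative.ext h (by simpa using h0)

/-- Differentiation strips the outermost integral, hence the first letter, of every word. This
equation drives the inductions on degree below. -/
theorem derivative_fliess {m : ℕ} (c : Series m) (u : Fin m → PowerSeries ℝ) :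
    derivative ℝ (fliess c u) = ∑ i, extendInput u i * fliess (leftDeriv i c) u := by
  ext n
  rw [coeff_derivative, coeff_fliess c u le_rfl, sum_wordsLE_succ, map_sum]
  have h1 : coeff (n + 1) (iteratedIntegral u []) = 0 := by simp [iteratedIntegral, coeff_one]
  rw [h1, mul_zero, zero_add, Finset.sum_mul]
  refine Finset.sum_congr rfl fun i _ => ?_
  have h2 : ∀ p ∈ Finset.HasAntidiagonal.antidiagonal n, coeff p.1 (extendInput u i) *
      coeff p.2 (fliess (leftDeriv i c) u) = ∑ η ∈ wordsLE (Fin (m + 1)) n,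
        c (i :: η) * (coeff p.1 (extendInput u i) * coeff p.2 (iteratedIntegral u η)) := by
    intro p hp
    rw [coeff_fliess _ u (Finset.HasAntidiagonal.antidiagonal.snd_le hp), Finset.mul_sum]
    exact Finset.sum_congr rfl fun η _ => by rw [leftDeriv]; ring
  rw [coeff_mul, Finset.sum_congr rfl h2, Finset.sum_comm, Finset.sum_mul]
  refine Finset.sum_congr rfl fun η _ => ?_
  rw [← Finset.mul_sum, ← coeff_mul, iteratedIntegral, coeff_succ_integral, extendInput]
  field_simp

theorem fliess_one {m : ℕ} (u : Fin m → PowerSeries ℝ) : fliess one u = 1 := by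
  ext n
  rw [coeff_fliess one u le_rfl, Finset.sum_eq_single []]
  · simp [one, iteratedIntegral]
  · intro η _ hη
    cases η with
    | nil => exact absurd rfl hη
    | cons i η => simp [one]
  · simp [mem_wordsLE]

theorem fliess_zero {m : ℕ} (u : Fin m → PowerSeries ℝ) : fliess (0 : Series m) u = 0 := by
  ext n
  simp [coeff_fliess _ u le_rfl]

theorem leftDeriv_prepend {m : ℕ} (i j : Fin (m + 1)) (c : Series m) :
    leftDeriv j (prepend i c) = if j = i then c else 0 := by
  funext η
  by_cases h : j = i <;> simp [leftDeriv, prepend, h]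

theorem fliess_prepend {m : ℕ} (i : Fin (m + 1)) (c : Series m) (u : Fin m → PowerSeries ℝ) :
    fliess (prepend i c) u = integral (extendInput u i * fliess c u) := by
  refine eq_of_derivative_eq ?_ ?_
  · rw [coeff_zero_fliess, coeff_zero_integral, prepend]
  · rw [derivative_fliess, derivative_integral, Finset.sum_eq_single i]
    · rw [leftDeriv_prepend, if_pos rfl]
    · intro j _ hj
      rw [leftDeriv_prepend, if_neg hj, fliess_zero, mul_zero]
    · simp

/-! ### Shuffle corresponds to the pointwise product. -/

theorem coeff_mul_congr {n : ℕ} {f f' g g' : PowerSeries ℝ}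
    (hf : ∀ k ≤ n, coeff k f = coeff k f') (hg : ∀ k ≤ n, coeff k g = coeff k g') :
    coeff n (f * g) = coeff n (f' * g') := by
  rw [coeff_mul, coeff_mul]
  refine Finset.sum_congr rfl fun p hp => ?_
  rw [hf _ (Finset.HasAntidiagonal.antidiagonal.fst_le hp), hg _ (Finset.HasAntidiagonal.antidiagonal.snd_le hp)]

theorem shuffle_nil {m : ℕ} (c d : Series m) : shuffle c d [] = c [] * d [] := by
  simp [shuffle, unshuffle]

theorem leftDeriv_shuffle {m : ℕ} (i : Fin (m + 1)) (c d : Series m) :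
    leftDeriv i (shuffle c d) = shuffle (leftDeriv i c) d + shuffle c (leftDeriv i d) := by
  funext η
  simp [leftDeriv, shuffle, unshuffle, Function.comp_def]

/-- Left shifts are derivations of the shuffle product, so both sides obey the same differential
equation with the same constant term. -/
theorem fliess_shuffle {m : ℕ} (c d : Series m) (u : Fin m → PowerSeries ℝ) :
    fliess (shuffle c d) u = fliess c u * fliess d u := by
  -- A coefficient of a product involves all lower degrees of its factors, hence the bound `k ≤ n`;
  -- `c` and `d` vary because the induction passes to their shifts.
  have key : ∀ n : ℕ, ∀ k ≤ n, ∀ c d : Series m,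
      coeff k (fliess (shuffle c d) u) = coeff k (fliess c u * fliess d u) := by
    intro n
    induction n with
    | zero =>
      intro k hk c d
      obtain rfl : k = 0 := by omega
      simp [coeff_mul, coeff_zero_fliess, shuffle_nil, - coeff_zero_eq_constantCoeff]
    | succ n ih =>
      intro k hk c d
      cases k with
      | zero => exact ih 0 (Nat.zero_le _) c d
      | succ k =>
        have h : coeff k (derivative ℝ (fliess (shuffle c d) u)) =
            coeff k (derivative ℝ (fliess c u * fliess d u)) := by
          rw [Derivation.leibniz, derivative_fliess, derivative_fliess, derivative_fliess,
            smul_eq_mul, smul_eq_mul, Finset.mul_sum, Finset.mul_sum, ← Finset.sum_add_distrib,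
            map_sum, map_sum]
          refine Finset.sum_congr rfl fun i _ => ?_
          rw [leftDeriv_shuffle, fliess_add]
          have e : fliess c u * (extendInput u i * fliess (leftDeriv i d) u) +
              fliess d u * (extendInput u i * fliess (leftDeriv i c) u) = extendInput u i *
              (fliess (leftDeriv i c) u * fliess d u + fliess c u * fliess (leftDeriv i d) u) := by
            ring
          rw [e]
          refine coeff_mul_congr (fun _ _ => rfl) fun j hj => ?_
          rw [map_add, map_add, ih j (by omega), ih j (by omega)]
        rw [coeff_derivative, coeff_derivative] at h
        exact mul_right_cancel₀ (by positivity) h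
  ext n
  exact key n n le_rfl c d

/-! ### The composition products as substitutions of inputs. -/

/-- Substitution of a locally finite family of series whose Chen--Fliess series are the iterated
integrals of another input. -/
theorem fliess_finsum {ℓ m : ℕ} (c : Series ℓ) (P : List (Fin (ℓ + 1)) → Series m)
    (u : Fin m → PowerSeries ℝ) (w : Fin ℓ → PowerSeries ℝ)
    (hP : ∀ η ξ, ξ.length < η.length → P η ξ = 0)
    (hw : ∀ η, fliess (P η) u = iteratedIntegral w η) :
    fliess (fun ξ => ∑ᶠ η, c η * P η ξ) u = fliess c w := by
  ext n
  rw [coeff_fliess _ u le_rfl, coeff_fliess c w le_rfl]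
  have h : ∀ ξ ∈ wordsLE (Fin (m + 1)) n,
      (∑ᶠ η, c η * P η ξ) * coeff n (iteratedIntegral u ξ) =
      ∑ η ∈ wordsLE (Fin (ℓ + 1)) n, c η * (P η ξ * coeff n (iteratedIntegral u ξ)) := by
    intro ξ hξ
    rw [finsum_eq_sum_wordsLE _ n, Finset.sum_mul]
    · exact Finset.sum_congr rfl fun η _ => by ring
    · intro η hη
      rw [hP η ξ ((mem_wordsLE.1 hξ).trans_lt hη), mul_zero]
  rw [Finset.sum_congr rfl h, Finset.sum_comm]
  refine Finset.sum_congr rfl fun η _ => ?_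
  rw [← Finset.mul_sum, ← coeff_fliess _ u le_rfl, hw]

theorem fliess_extend {ℓ m : ℕ} (d : VSeries ℓ m) (u : Fin m → PowerSeries ℝ) (i : Fin (ℓ + 1)) :
    fliess (extend d i) u = extendInput (chenFliess d u) i := by
  cases i using Fin.cases with
  | zero => simp [extend, extendInput, fliess_one]
  | succ i => simp [extend, extendInput, chenFliess_apply]

theorem fliess_compWord {ℓ m : ℕ} (d : VSeries ℓ m) (u : Fin m → PowerSeries ℝ)
    (η : List (Fin (ℓ + 1))) :
    fliess (compWord d η) u = iteratedIntegral (chenFliess d u) η := by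
  induction η with
  | nil => rw [compWord, fliess_one, iteratedIntegral]
  | cons i η ih =>
    rw [compWord, fliess_prepend, fliess_shuffle, ih, fliess_extend, iteratedIntegral]
    simp [extendInput]

theorem chenFliess_comp {k ℓ m : ℕ} (c : VSeries k ℓ) (d : VSeries ℓ m)
    (u : Fin m → PowerSeries ℝ) :
    chenFliess (comp c d) u = chenFliess c (chenFliess d u) := by
  funext j
  exact fliess_finsum (c j) (compWord d) u _ (compWord_eq_zero d) (fliess_compWord d u)

theorem fliess_mixWord {m : ℕ} (d : VSeries m m) (v : Fin m → PowerSeries ℝ)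
    (η : List (Fin (m + 1))) :
    fliess (mixWord d η) v = iteratedIntegral (v * chenFliess d v) η := by
  induction η with
  | nil => rw [mixWord, fliess_one, iteratedIntegral]
  | cons i η ih =>
    rw [mixWord, fliess_prepend, fliess_shuffle, ih, fliess_extend, iteratedIntegral, ← mul_assoc]
    congr 2
    cases i using Fin.cases <;> simp [extendInput]

theorem chenFliess_mix {p m : ℕ} (c : VSeries p m) (d : VSeries m m)
    (v : Fin m → PowerSeries ℝ) :
    chenFliess (mix c d) v = chenFliess c (v * chenFliess d v) := by
  funext j
  exact fliess_finsum (c j) (mixWord d) v _ (mixWord_eq_zero d) (fliess_mixWord d v)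

theorem chenFliess_vshuffle {ℓ m : ℕ} (c d : VSeries ℓ m) (u : Fin m → PowerSeries ℝ) :
    chenFliess (vshuffle c d) u = chenFliess c u * chenFliess d u :=
  funext fun _ => fliess_shuffle _ _ u

theorem chenFliess_vone {ℓ m : ℕ} (u : Fin m → PowerSeries ℝ) :
    chenFliess (vone : VSeries ℓ m) u = 1 :=
  funext fun _ => fliess_one u

theorem chenFliess_star {m : ℕ} (c d : VSeries m m) (v : Fin m → PowerSeries ℝ) :
    chenFliess (star c d) v = chenFliess d v * chenFliess c (v * chenFliess d v) := by
  rw [star, chenFliess_vshuffle, chenFliess_mix]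

/-! Causality of Chen--Fliess series. -/

/-- Each integration raises the degree by one, so inputs known below degree `n` fix the result up to
degree `n` inclusive. -/
theorem coeff_iteratedIntegral_congr {m n : ℕ} {u u' : Fin m → PowerSeries ℝ}
    (h : ∀ i, ∀ k < n, coeff k (u i) = coeff k (u' i)) (η : List (Fin (m + 1))) :
    ∀ k ≤ n, coeff k (iteratedIntegral u η) = coeff k (iteratedIntegral u' η) := by
  induction η with
  | nil => intro k _; rfl
  | cons i η ih =>
    intro k hk
    cases k with
    | zero => rw [iteratedIntegral, iteratedIntegral, coeff_zero_integral, coeff_zero_integral]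
    | succ k =>
      rw [iteratedIntegral, iteratedIntegral, coeff_succ_integral, coeff_succ_integral]
      congr 1
      refine coeff_mul_congr (fun a ha => ?_) fun b hb => ih b (by omega)
      cases i using Fin.cases with
      | zero => rfl
      | succ i => exact h i a (by omega)

theorem coeff_fliess_congr {m n : ℕ} {u u' : Fin m → PowerSeries ℝ} (c : Series m)
    (h : ∀ i, ∀ k < n, coeff k (u i) = coeff k (u' i)) (k : ℕ) (hk : k ≤ n) :
    coeff k (fliess c u) = coeff k (fliess c u') := by
  rw [coeff_fliess c u le_rfl, coeff_fliess c u' le_rfl]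
  exact Finset.sum_congr rfl fun η _ => by rw [coeff_iteratedIntegral_congr h η k hk]

/-- The input `u` of the closed loop is determined by the external input. -/
theorem closedLoop_input_unique {q m : ℕ} {c : VSeries q m} {d : VSeries m q}
    {v u u' : Fin m → PowerSeries ℝ} (h : u = v * chenFliess d (chenFliess c u))
    (h' : u' = v * chenFliess d (chenFliess c u')) : u = u' := by
  -- Going round the loop gains a degree: agreement of the inputs below `n` forces agreement of the
  -- feedback signals through degree `n`.
  have key : ∀ n : ℕ, ∀ i, ∀ k < n, coeff k (u i) = coeff k (u' i) := by
    intro n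
    induction n with
    | zero => intro i k hk; omega
    | succ n ih =>
      intro i k hk
      rw [h, h', Pi.mul_apply, Pi.mul_apply]
      refine coeff_mul_congr (fun _ _ => rfl) fun a ha => ?_
      refine coeff_fliess_congr (n := n) (d i) (fun j b hb => ?_) a (by omega)
      exact coeff_fliess_congr (c j) ih b hb.le
  funext i
  ext k
  exact key (k + 1) i k k.lt_succ_self

/-! A series is determined by its Chen--Fliess series. -/

/-- Only `b` terms survive. The index of `g` is written `k + 1 + b'` with `b' < b` to fit the strong
induction on `b` that follows. -/
theorem coeff_add_mul_of_low_eq_zero {f g : PowerSeries ℝ} {k : ℕ}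
    (hg : ∀ a < k + 1, coeff a g = 0) (b : ℕ) :
    coeff (k + b) (f * g) =
      ∑ a ∈ Finset.range b, coeff a f * coeff (k + 1 + (b - 1 - a)) g := by
  rw [coeff_mul, Finset.Nat.sum_antidiagonal_eq_sum_range_succ
    (fun i j => coeff i f * coeff j g)]
  symm
  rw [← Finset.sum_subset (Finset.range_subset_range.2 (show b ≤ (k + b).succ by omega))]
  · refine Finset.sum_congr rfl fun a ha => ?_
    rw [Finset.mem_range] at ha
    congr 3
    omega
  · intro a ha ha'
    rw [Finset.mem_range] at ha ha'
    rw [hg _ (by omega), mul_zero]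

/-- Perturbing `u_i` by `X ^ k` and differentiating gives `X ^ k · F_{x_i⁻¹ c}`, which supplies the
limit, plus differences of shifted series multiplied by `u_j`. The latter enter only through offsets
below `b`, where induction bounds them by `O(1/k)`. The factor `k + b + 1` comes from
differentiation. -/
theorem tendsto_coeff_perturbed {m : ℕ} (u : Fin m → PowerSeries ℝ) (i : Fin m) (b : ℕ) :
    ∀ c : Series m, Tendsto (fun k : ℕ => ((k + b : ℕ) + 1 : ℝ) *
      coeff (k + b + 1) (fliess c (u + Pi.single i (X ^ k)) - fliess c u)) atTop
      (𝓝 (coeff b (fliess (leftDeriv i.succ c) u))) := by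
  induction b using Nat.strong_induction_on with
  | _ b ih =>
  intro c
  have hlow : ∀ k : ℕ, ∀ j, ∀ a < k,
      coeff a ((u + Pi.single i (X ^ k) : Fin m → PowerSeries ℝ) j) = coeff a (u j) := by
    intro k j a ha
    by_cases hj : j = i
    · subst hj
      simp [coeff_X_pow, ha.ne]
    · simp [hj]
  have hzero : ∀ (e : Series m) (k : ℕ), ∀ a < k + 1,
      coeff a (fliess e (u + Pi.single i (X ^ k)) - fliess e u) = 0 := by
    intro e k a ha
    rw [map_sub, coeff_fliess_congr e (hlow k) a (by omega), sub_self]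
  have hsmall : ∀ b' < b, ∀ e : Series m, Tendsto (fun k : ℕ =>
      coeff (k + 1 + b') (fliess e (u + Pi.single i (X ^ k)) - fliess e u)) atTop (𝓝 0) := by
    intro b' hb' e
    have h1 : Tendsto (fun k : ℕ => ((k + b' : ℕ) + 1 : ℝ)) atTop atTop :=
      tendsto_atTop_add_const_right _ _
        (tendsto_natCast_atTop_atTop.comp (tendsto_add_atTop_nat b'))
    have h2 := (ih b' hb' e).div_atTop h1
    refine h2.congr fun k => ?_
    rw [mul_div_cancel_left₀ _ (by positivity), show k + b' + 1 = k + 1 + b' by omega]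
  have hstep : ∀ k : ℕ, ((k + b : ℕ) + 1 : ℝ) *
      coeff (k + b + 1) (fliess c (u + Pi.single i (X ^ k)) - fliess c u) =
      (∑ j, ∑ a ∈ Finset.range b, coeff a (extendInput u j) * coeff (k + 1 + (b - 1 - a))
        (fliess (leftDeriv j c) (u + Pi.single i (X ^ k)) - fliess (leftDeriv j c) u)) +
      coeff b (fliess (leftDeriv i.succ c) (u + Pi.single i (X ^ k))) := by
    intro k
    rw [mul_comm, ← coeff_derivative, map_sub, derivative_fliess, derivative_fliess]
    have h1 : ∀ j, extendInput (u + Pi.single i (X ^ k)) j =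
        extendInput u j + if j = i.succ then X ^ k else 0 := by
      intro j
      cases j using Fin.cases with
      | zero => simp [extendInput, (Fin.succ_ne_zero i).symm]
      | succ j => simp [extendInput, Pi.single_apply]
    simp only [h1, add_mul, Finset.sum_add_distrib, ite_mul, zero_mul]
    rw [Finset.sum_ite_eq' Finset.univ, if_pos (Finset.mem_univ _), add_sub_right_comm, map_add,
      ← Finset.sum_sub_distrib, map_sum, add_comm k b, coeff_X_pow_mul]
    congr 1
    refine Finset.sum_congr rfl fun j _ => ?_
    rw [← mul_sub, add_comm b k, coeff_add_mul_of_low_eq_zero (hzero _ k)]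
  simp only [hstep]
  rw [← zero_add (coeff b (fliess (leftDeriv i.succ c) u))]
  refine Tendsto.add ?_ ?_
  · have h0 : ∀ j ∈ (Finset.univ : Finset (Fin (m + 1))), Tendsto (fun k : ℕ =>
        ∑ a ∈ Finset.range b, coeff a (extendInput u j) * coeff (k + 1 + (b - 1 - a))
        (fliess (leftDeriv j c) (u + Pi.single i (X ^ k)) - fliess (leftDeriv j c) u))
        atTop (𝓝 0) := by
      intro j _
      rw [← Finset.sum_const_zero (s := Finset.range b)]
      refine tendsto_finsetSum _ fun a ha => ?_
      rw [Finset.mem_range] at ha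
      rw [← mul_zero (coeff a (extendInput u j))]
      exact (hsmall (b - 1 - a) (by omega) _).const_mul _
    simpa using tendsto_finsetSum _ h0
  -- Once `k ≥ b`, causality hides the perturbation from degree `b`.
  · refine tendsto_const_nhds.congr' ?_
    filter_upwards [eventually_ge_atTop b] with k hk
    exact (coeff_fliess_congr _ (hlow k) b hk).symm

/-- The perturbation limit handles the letters `x_i` with `i ≥ 1`. For `x₀`, whose input cannot be
varied, the derivative formula leaves just that term because `u₀ = 1`. -/
theorem fliess_leftDeriv_eq_zero {m : ℕ} {c : Series m} (h : ∀ u, fliess c u = 0)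
    (i : Fin (m + 1)) (u : Fin m → PowerSeries ℝ) : fliess (leftDeriv i c) u = 0 := by
  have hsucc : ∀ i : Fin m, fliess (leftDeriv i.succ c) u = 0 := by
    intro i
    ext b
    have h1 := tendsto_coeff_perturbed u i b c
    simp only [h, sub_zero, map_zero, mul_zero] at h1
    rw [map_zero]
    exact tendsto_nhds_unique h1 tendsto_const_nhds
  cases i using Fin.cases with
  | succ i => exact hsucc i
  | zero =>
    have h2 := derivative_fliess c u
    rw [h, map_zero, Fin.sum_univ_succ] at h2
    simpa [hsucc, extendInput] using h2.symm

theorem eq_zero_of_fliess_eq_zero {m : ℕ} {c : Series m} (h : ∀ u, fliess c u = 0) : c = 0 := by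
  funext η
  induction η generalizing c with
  | nil => rw [← coeff_zero_fliess c 0, h, map_zero, Pi.zero_apply]
  | cons i η ih => exact ih (fliess_leftDeriv_eq_zero h i)

theorem chenFliess_injective {ℓ m : ℕ} {c d : VSeries ℓ m}
    (h : ∀ u, chenFliess c u = chenFliess d u) : c = d := by
  funext j
  refine sub_eq_zero.1 (eq_zero_of_fliess_eq_zero fun u => ?_)
  rw [fliess_sub, sub_eq_zero]
  exact congrFun (h u) j

/-! Algebraic identities, obtained from those of the Chen--Fliess series. -/

theorem fliess_smul {m : ℕ} (a : ℝ) (c : Series m) (u : Fin m → PowerSeries ℝ) :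
    fliess (a • c) u = a • fliess c u := by
  ext n
  simp only [map_smul, coeff_fliess _ u le_rfl, Finset.mul_sum, Pi.smul_apply, smul_eq_mul,
    mul_assoc]

theorem isShuffleInverse_iff {ℓ m : ℕ} {d e : VSeries ℓ m} :
    IsShuffleInverse d e ↔ ∀ u, chenFliess d u * chenFliess e u = 1 := by
  refine ⟨fun h u => ?_, fun h => chenFliess_injective fun u => ?_⟩
  · rw [← chenFliess_vshuffle, show vshuffle d e = vone from h, chenFliess_vone]
  · rw [chenFliess_vshuffle, h, chenFliess_vone]

theorem IsShuffleInverse.unique {ℓ m : ℕ} {d e e' : VSeries ℓ m} (h : IsShuffleInverse d e)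
    (h' : IsShuffleInverse d e') : e = e' := by
  rw [isShuffleInverse_iff] at h h'
  refine chenFliess_injective fun u => left_inv_eq_right_inv (a := chenFliess d u) ?_ (h' u)
  rw [mul_comm, h]

theorem purelyImproper_of_vshuffle_eq_vone {ℓ m : ℕ} {d e : VSeries ℓ m}
    (h : vshuffle d e = vone) : PurelyImproper d := by
  intro i hi
  have h1 : shuffle (d i) (e i) [] = one [] := congrFun (congrFun h i) []
  rw [shuffle_nil, hi, zero_mul] at h1
  exact zero_ne_one h1

theorem star_assoc {m : ℕ} (a b c : VSeries m m) : star (star a b) c = star a (star b c) := by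
  refine chenFliess_injective fun v => ?_
  simp only [chenFliess_star, mul_assoc]

theorem star_vone {m : ℕ} (a : VSeries m m) : star a vone = a := by
  refine chenFliess_injective fun v => ?_
  simp only [chenFliess_star, chenFliess_vone, one_mul, mul_one]

theorem vone_star {m : ℕ} (a : VSeries m m) : star vone a = a := by
  refine chenFliess_injective fun v => ?_
  simp only [chenFliess_star, chenFliess_vone, mul_one]

theorem IsStarInverse.unique {m : ℕ} {d e e' : VSeries m m} (h : IsStarInverse d e)
    (h' : IsStarInverse d e') : e = e' := by
  rw [← star_vone e, ← h'.1, ← star_assoc, h.2, vone_star]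

/-! Contractions for the ultrametric. -/

/-- The coefficients of `c` and `d` agree on all words of length less than `n`. -/
def Agree {ℓ m : ℕ} (n : ℕ) (c d : VSeries ℓ m) : Prop :=
  ∀ i η, List.length η < n → c i η = d i η

/-- Agreement on words of length less than `n` implies agreement of the images on words of length
at most `n`. -/
def IsStrongContraction {k ℓ m p : ℕ} (f : VSeries k m → VSeries ℓ p) : Prop :=
  ∀ n e e', Agree n e e' → Agree (n + 1) (f e) (f e')

theorem Agree.mono {ℓ m k n : ℕ} {c d : VSeries ℓ m} (h : Agree n c d) (hk : k ≤ n) :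
    Agree k c d := fun i η hη => h i η (hη.trans_le hk)

theorem eq_of_forall_agree {ℓ m : ℕ} {c d : VSeries ℓ m} (h : ∀ n, Agree n c d) : c = d :=
  funext fun i => funext fun η => h (η.length + 1) i η (Nat.lt_succ_self _)

theorem IsStrongContraction.comp {k ℓ m p r s : ℕ} {g : VSeries ℓ p → VSeries r s}
    {f : VSeries k m → VSeries ℓ p} (hg : IsStrongContraction g) (hf : IsStrongContraction f) :
    IsStrongContraction fun e => g (f e) :=
  fun n _ _ h => hg n _ _ ((hf n _ _ h).mono n.le_succ)

theorem IsStrongContraction.fixedPoint_unique {ℓ m : ℕ} {f : VSeries ℓ m → VSeries ℓ m}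
    (hf : IsStrongContraction f) {e e' : VSeries ℓ m} (h : f e = e) (h' : f e' = e') :
    e = e' := by
  refine eq_of_forall_agree fun n => ?_
  induction n with
  | zero => intro i η hη; omega
  | succ n ih =>
    rw [← h, ← h']
    exact hf n e e' ih

theorem IsStrongContraction.exists_fixedPoint {ℓ m : ℕ} {f : VSeries ℓ m → VSeries ℓ m}
    (hf : IsStrongContraction f) : ∃ e, f e = e := by
  have hx : ∀ k n, k ≤ n → Agree k (f^[k] 0) (f^[n] 0) := by
    intro k
    induction k with
    | zero => intro n _ i η hη; omega
    | succ k ih =>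
      intro n hn
      obtain ⟨n, rfl⟩ : ∃ n', n = n' + 1 := ⟨n - 1, by omega⟩
      rw [Function.iterate_succ_apply', Function.iterate_succ_apply']
      exact hf k _ _ (ih n (by omega))
  -- The limit of the iterates: the coefficient at `η` is stationary from iterate `η.length + 1` on.
  let e : VSeries ℓ m := fun i η => f^[η.length + 1] 0 i η
  have he : ∀ n, Agree n e (f^[n] 0) := fun n i η hη => hx (η.length + 1) n hη i η (by omega)
  refine ⟨e, eq_of_forall_agree fun n => ?_⟩
  intro i η hη
  have h1 := hf n _ _ (he n) i η (by omega)
  rw [← Function.iterate_succ_apply' f] at h1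
  exact h1.trans (he (n + 1) i η (by omega)).symm

/-! ### Degree estimates for the products. -/

theorem length_fst_of_mem_unshuffle {α : Type} {η : List α} :
    ∀ {p : List α × List α}, p ∈ unshuffle η → p.1.length ≤ η.length := by
  induction η with
  | nil => simp [unshuffle]
  | cons x w ih =>
    intro p hp
    simp only [unshuffle, List.mem_append, List.mem_map] at hp
    rcases hp with ⟨r, hr, rfl⟩ | ⟨r, hr, rfl⟩
    · simpa using ih hr
    · exact (ih hr).trans (by simp)

theorem shuffle_congr {m n : ℕ} {c c' d d' : Series m}
    (hc : ∀ ξ, List.length ξ < n → c ξ = c' ξ) (hd : ∀ ξ, List.length ξ < n → d ξ = d' ξ)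
    (η : List (Fin (m + 1))) (hη : η.length < n) : shuffle c d η = shuffle c' d' η := by
  unfold shuffle
  congr 1
  refine List.map_congr_left fun p hp => ?_
  rw [hc _ ((length_fst_of_mem_unshuffle hp).trans_lt hη),
    hd _ ((length_of_mem_unshuffle hp).trans_lt hη)]

theorem prepend_congr {m n : ℕ} (i : Fin (m + 1)) {c c' : Series m}
    (hc : ∀ ξ, List.length ξ < n → c ξ = c' ξ)
    (η : List (Fin (m + 1))) (hη : η.length < n + 1) : prepend i c η = prepend i c' η := by
  cases η with
  | nil => rfl
  | cons j w =>
    simp only [List.length_cons] at hη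
    simp [prepend, hc w (by omega)]

theorem Agree.extend {ℓ m n : ℕ} {d d' : VSeries ℓ m} (h : Agree n d d') (i : Fin (ℓ + 1))
    (η : List (Fin (m + 1))) (hη : η.length < n) :
    ChenFliess.extend d i η = ChenFliess.extend d' i η := by
  cases i using Fin.cases with
  | zero => rfl
  | succ i => exact h i η hη

theorem Agree.compWord {ℓ m n : ℕ} {d d' : VSeries ℓ m} (h : Agree n d d')
    (η : List (Fin (ℓ + 1))) :
    ∀ ξ, List.length ξ < n + 1 → compWord d η ξ = ChenFliess.compWord d' η ξ := by
  induction η with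
  | nil => intro ξ _; rfl
  | cons i η ih =>
    exact prepend_congr 0 (shuffle_congr (h.extend i) fun ξ hξ => ih ξ (by omega))

theorem Agree.mixWord {m n : ℕ} {d d' : VSeries m m} (h : Agree n d d')
    (η : List (Fin (m + 1))) :
    ∀ ξ, List.length ξ < n + 1 → mixWord d η ξ = ChenFliess.mixWord d' η ξ := by
  induction η with
  | nil => intro ξ _; rfl
  | cons i η ih =>
    exact prepend_congr i (shuffle_congr (h.extend i) fun ξ hξ => ih ξ (by omega))

theorem isStrongContraction_comp {k ℓ m : ℕ} (c : VSeries k ℓ) :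
    IsStrongContraction fun d : VSeries ℓ m => comp c d :=
  fun _ _ _ h _ ξ hξ => finsum_congr fun η => by rw [h.compWord η ξ hξ]

theorem isStrongContraction_mix {p m : ℕ} (c : VSeries p m) :
    IsStrongContraction fun d : VSeries m m => mix c d :=
  fun _ _ _ h _ ξ hξ => finsum_congr fun η => by rw [h.mixWord η ξ hξ]

/-- Since `c` has no constant term, every contributing splitting gives `c` at least one letter, so
`d` is read only on strictly shorter words. -/
theorem shuffle_congr_of_proper {m : ℕ} (n : ℕ) : ∀ {c d d' : Series m}, c [] = 0 →
    (∀ ξ, List.length ξ < n → d ξ = d' ξ) → ∀ η, List.length η < n + 1 →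
    shuffle c d η = shuffle c d' η := by
  induction n with
  | zero =>
    intro c d d' hc _ η hη
    obtain rfl : η = [] := List.length_eq_zero_iff.1 (by omega)
    rw [shuffle_nil, shuffle_nil, hc, zero_mul, zero_mul]
  | succ n ih =>
    intro c d d' hc hd η hη
    cases η with
    | nil => rw [shuffle_nil, shuffle_nil, hc, zero_mul, zero_mul]
    | cons i η =>
      simp only [List.length_cons] at hη
      change leftDeriv i (shuffle c d) η = leftDeriv i (shuffle c d') η
      rw [leftDeriv_shuffle, leftDeriv_shuffle, Pi.add_apply, Pi.add_apply,
        shuffle_congr (fun _ _ => rfl) hd η (by omega),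
        ih (d := leftDeriv i d) (d' := leftDeriv i d') hc
          (fun ξ hξ => hd (i :: ξ) (by simpa using hξ)) η (by omega)]

/-! ### Existence of shuffle and `⋆` inverses. -/

theorem PurelyImproper.exists_isShuffleInverse {ℓ m : ℕ} {d : VSeries ℓ m}
    (hd : PurelyImproper d) : ∃ e, IsShuffleInverse d e := by
  -- With `a = d i []`, the equation `d ш e = 1` is solved for the `a`-part: `e = a⁻¹ (1 - (d - a) ш
  -- e)`, where `d - a` is proper.
  let f : VSeries ℓ m → VSeries ℓ m := fun e i =>
    (d i [])⁻¹ • (one - shuffle (d i - d i [] • one) (e i))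
  have hf : IsStrongContraction f := by
    intro n e e' h i η hη
    have h1 := shuffle_congr_of_proper n (c := d i - d i [] • one) (by simp [one]) (h i) η hη
    simp only [f, Pi.smul_apply, Pi.sub_apply, h1]
  obtain ⟨e, he⟩ := hf.exists_fixedPoint
  refine ⟨e, isShuffleInverse_iff.2 fun u => funext fun i => ?_⟩
  have h1 : d i [] • e i = one - shuffle (d i - d i [] • one) (e i) := by
    conv_lhs => rw [← he]
    exact smul_inv_smul₀ (hd i) _
  have h2 := congrArg (fun c => fliess c u) h1
  simp only [fliess_smul, fliess_sub, fliess_shuffle, fliess_one, sub_mul, smul_one_mul] at h2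
  simp only [Pi.mul_apply, Pi.one_apply, chenFliess_apply]
  linear_combination h2

/-- The equation `h ш (g ↶ h) = 𝟙` says `h = g^{ш -1} ↶ h`, a fixed-point problem for a strong
contraction. Pure improperness of `h` allows the construction to be repeated on `h`. -/
theorem PurelyImproper.exists_star_eq_vone {m : ℕ} {g : VSeries m m} (hg : PurelyImproper g) :
    ∃ h, PurelyImproper h ∧ star g h = vone := by
  obtain ⟨g', hg'⟩ := hg.exists_isShuffleInverse
  obtain ⟨h, hh⟩ := (isStrongContraction_mix g').exists_fixedPoint
  have h1 : star g h = vone := by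
    refine chenFliess_injective fun v => ?_
    have h2 : chenFliess h v = chenFliess g' (v * chenFliess h v) := by
      conv_lhs => rw [← hh]
      exact chenFliess_mix g' h v
    rw [chenFliess_star, chenFliess_vone]
    nth_rewrite 1 [h2]
    rw [mul_comm]
    exact isShuffleInverse_iff.1 hg' _
  exact ⟨h, purelyImproper_of_vshuffle_eq_vone h1, h1⟩

/-- As in a group: the right inverse `h` of `g` has its own right inverse, which must equal `g`. -/
theorem PurelyImproper.exists_isStarInverse {m : ℕ} {g : VSeries m m} (hg : PurelyImproper g) :
    ∃ h, IsStarInverse g h := by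
  obtain ⟨h, hh, h1⟩ := hg.exists_star_eq_vone
  obtain ⟨k, -, h2⟩ := hh.exists_star_eq_vone
  have hk : g = k := by rw [← star_vone g, ← h2, ← star_assoc, h1, vone_star]
  exact ⟨h, h1, hk ▸ h2⟩

theorem PurelyImproper.isShuffleInverse_shuffleInv {ℓ m : ℕ} {d : VSeries ℓ m}
    (hd : PurelyImproper d) : IsShuffleInverse d (shuffleInv d) :=
  Classical.epsilon_spec hd.exists_isShuffleInverse

theorem PurelyImproper.isStarInverse_starInv {m : ℕ} {d : VSeries m m}
    (hd : PurelyImproper d) : IsStarInverse d (starInv d) :=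
  Classical.epsilon_spec hd.exists_isStarInverse

/-- Right composition with `c` respects shuffles, so `d ∘ c` is a shuffle inverse of `e ∘ c`. -/
theorem IsShuffleInverse.purelyImproper_comp {k ℓ m : ℕ} {d e : VSeries k ℓ}
    (h : IsShuffleInverse d e) (c : VSeries ℓ m) : PurelyImproper (comp e c) := by
  refine purelyImproper_of_vshuffle_eq_vone (e := comp d c) (isShuffleInverse_iff.2 fun u => ?_)
  rw [chenFliess_comp, chenFliess_comp, mul_comm]
  exact isShuffleInverse_iff.1 h _

/-! ### The feedback product and the closed loop. -/

/-- The feedback product is a fixed point of `e ↦ c ↶ (d ∘ e)`. -/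
theorem mix_comp_feedback {q m : ℕ} (c : VSeries q m) {d : VSeries m q} (hd : PurelyImproper d) :
    mix c (comp d (feedback c d)) = feedback c d := by
  have hi := hd.isShuffleInverse_shuffleInv
  have hs := (hi.purelyImproper_comp c).isStarInverse_starInv.1
  -- Both sides are shuffle inverses of `d^{ш -1} ∘ (c ↶ h)`, where `h` is the `⋆`-inverse: the
  -- right one by `g ⋆ h = 𝟙` for `g = d^{ш -1} ∘ c`, the left one by the definition of `d^{ш -1}`.
  have key : comp d (feedback c d) = starInv (comp (shuffleInv d) c) := by
    rw [feedback]
    generalize starInv (comp (shuffleInv d) c) = h at hs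
    refine chenFliess_injective fun v => ?_
    have h1 := congrArg (fun a => chenFliess a v) hs
    simp only [chenFliess_star, chenFliess_comp, chenFliess_vone] at h1
    rw [chenFliess_comp, chenFliess_mix]
    exact left_inv_eq_right_inv (isShuffleInverse_iff.1 hi _) ((mul_comm _ _).trans h1)
  rw [key, feedback]

theorem isStrongContraction_mix_comp {q m : ℕ} (c : VSeries q m) (d : VSeries m q) :
    IsStrongContraction fun e : VSeries q m => mix c (comp d e) :=
  (isStrongContraction_mix c).comp (isStrongContraction_comp d)

theorem isClosedLoop_iff {q m : ℕ} {c : VSeries q m} {d : VSeries m q}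
    {v u : Fin m → PowerSeries ℝ} {y : Fin q → PowerSeries ℝ} :
    IsClosedLoop c d v u y ↔ y = chenFliess c u ∧ u = v * chenFliess d y := by
  rw [IsClosedLoop, funext_iff (f := u)]
  rfl

/-- A fixed point of `e ↦ c ↶ (d ∘ e)` is a generating series of the closed loop. -/
theorem isClosedLoopSeries_of_fixedPoint {q m : ℕ} {c : VSeries q m} {d : VSeries m q}
    {e : VSeries q m} (he : mix c (comp d e) = e) : IsClosedLoopSeries c d e := by
  intro v y
  have h1 : chenFliess c (v * chenFliess d (chenFliess e v)) = chenFliess e v := by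
    conv_rhs => rw [← he]
    rw [chenFliess_mix, chenFliess_comp]
  constructor
  · rintro ⟨u, hu⟩
    obtain ⟨rfl, hu⟩ := isClosedLoop_iff.1 hu
    rw [← h1]
    exact congrArg _ (closedLoop_input_unique hu (by rw [h1]))
  · rintro rfl
    exact ⟨_, isClosedLoop_iff.2 ⟨h1.symm, rfl⟩⟩

theorem IsClosedLoopSeries.unique {q m : ℕ} {c : VSeries q m} {d : VSeries m q}
    {e e' : VSeries q m} (h : IsClosedLoopSeries c d e) (h' : IsClosedLoopSeries c d e') :
    e = e' :=
  chenFliess_injective fun v => (h' v _).1 ((h v _).2 rfl)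

theorem IsStrongContraction.kappa_le {k ℓ m p : ℕ} {f : VSeries k m → VSeries ℓ p}
    (hf : IsStrongContraction f) {σ : ℝ} (h0 : 0 < σ) (h1 : σ < 1) (e e' : VSeries k m) :
    kappa σ (f e) (f e') ≤ σ * kappa σ e e' := by
  by_cases hfe : f e = f e'
  · rw [kappa, if_pos hfe]
    refine mul_nonneg h0.le ?_
    rw [kappa]
    split_ifs
    · exact le_rfl
    · exact pow_nonneg h0.le _
  · have he : e ≠ e' := fun h => hfe (congrArg f h)
    rw [kappa, kappa, if_neg hfe, if_neg he, ← pow_succ']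
    -- As `σ < 1`, the claim is that the valuation grows by at least one; the contraction property
    -- is applied with `n` the valuation of `e - e'`.
    refine pow_le_pow_of_le_one h0.le h1.le (le_csInf ?_ ?_)
    · obtain ⟨i, hi⟩ := Function.ne_iff.1 hfe
      obtain ⟨η, hη⟩ := Function.ne_iff.1 hi
      exact ⟨_, i, η, sub_ne_zero.2 hη, rfl⟩
    · rintro n ⟨i, η, hη, rfl⟩
      by_contra hlt
      refine hη (sub_eq_zero.2 (hf _ e e' (fun j ξ hξ => ?_) i η (not_le.1 hlt)))
      by_contra hne
      exact Nat.notMem_of_lt_sInf hξ ⟨j, ξ, sub_ne_zero.2 hne, rfl⟩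

end ChenFliess

end

open ChenFliess in
theorem mainTheorem1 {m q : ℕ} (c : VSeries q m) (d : VSeries m q) (hd : PurelyImproper d) :
    -- the inverses in the definition of the feedback product exist and are unique
    (∀ e, IsShuffleInverse d e ↔ e = shuffleInv d) ∧
    (∀ e, IsStarInverse (comp (shuffleInv d) c) e ↔ e = starInv (comp (shuffleInv d) c)) ∧
    -- the feedback product is the generating series of the closed loop
    (∀ e, IsClosedLoopSeries c d e ↔ e = feedback c d) ∧
    -- the map `e ↦ c ↶ (d ∘ e)` is a strong contraction for `κ`
    (∀ σ : ℝ, 0 < σ → σ < 1 → ∀ e e' : VSeries q m,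
      kappa σ (mix c (comp d e)) (mix c (comp d e')) ≤ σ * kappa σ e e') ∧
    -- and the feedback product is its unique fixed point
    (∀ e : VSeries q m, Function.IsFixedPt (fun e => mix c (comp d e)) e ↔ e = feedback c d) := by
  have hi := hd.isShuffleInverse_shuffleInv
  have hs := (hi.purelyImproper_comp c).isStarInverse_starInv
  have hfix := mix_comp_feedback c hd
  have hcon := isStrongContraction_mix_comp c d
  refine ⟨fun e => ⟨fun h => h.unique hi, fun h => h ▸ hi⟩,
    fun e => ⟨fun h => h.unique hs, fun h => h ▸ hs⟩,
    fun e => ⟨fun h => h.unique (isClosedLoopSeries_of_fixedPoint hfix),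
      fun h => h ▸ isClosedLoopSeries_of_fixedPoint hfix⟩,
    fun σ h0 h1 e e' => hcon.kappa_le h0 h1 e e',
    fun e => ⟨fun h => hcon.fixedPoint_unique h hfix, fun h => h ▸ hfix⟩⟩
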